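/- **Setting.** For a finite alphabet $\Sigma$ and a next-token generator $f:\Sigma^*\to\Sigma$, let $\bar f(x)=\mathrm{append}(x,f(x))$, and for $T\ge 1$ let $f^{\mathsf{e2e}\text{-}T}(x)$ be the last token of $\bar f\circ\cdots\circ\bar f\,(x)$ ($T$ times). For a base class $\mathcal F\subseteq\Sigma^{\Sigma^*}$ let $\mathsf{e2e}^T(\mathcal F)=\{f^{\mathsf{e2e}\text{-}T}: f\in\mathcal F\}$. All dimensions take values in $\mathbb N\cup\{\infty\}$. $\mathrm{VCdim}$ and $\mathrm{Ndim}$ are the Vapnik–Chervonenkis and Natarajan dimensions. $\mathrm{Ldim}(\mathcal F)$ is the Littlestone dimension, i.e. the largest depth $d$ of a complete binary tree, with nodes labeled by $\Sigma^*$, such that for every root-to-leaf path $\epsilon\in\{0,1\}^d$, with node labels $x_1(\epsilon),\dots,x_d(\epsilon)$, some $f\in\mathcal F$ has $f(x_i(\epsilon))=\epsilon_i$ for all $i$. For $\Sigma=\{0,\dots,k-1\}$, $\mathrm{sfat}_1(\mathcal F)$ is the sequential fat-shattering dimension at scale $1$, i.e. the largest depth $d$ of such a tree $x$ for which there is a real-valued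 tree $s$ of depth $d$ such that for every $\epsilon\in\{\pm1\}^d$ some $f\in\mathcal F$ has $\epsilon_i\,(f(x_i(\epsilon))-s_i(\epsilon))\ge \tfrac12$ for all $i$. Here $\log$ is the natural logarithm. A learning rule $A$ maps finite labeled samples to predictors $\Sigma^*\to\Sigma$. It *learns $\mathsf{e2e}^T(\mathcal F)$ end-to-end with sample complexity $m(\varepsilon,\delta)$* if for every probability distribution $\mathcal D$ on $\Sigma^*$, every $f_*\in\mathcal F$ and all $0<\varepsilon,\delta<1$, with probability at least $1-\delta$ over $m=m(\varepsilon,\delta)$ i.i.d. draws $x_1,\dots,x_m\sim\mathcal D$, the predictor $h=A\big((x_i,f_*^{\mathsf{e2e}\text{-}T}(x_i))_{i\le m}\big)$ satisfies $\Pr_{x\sim\mathcal D}\big(h(x)\ne f_*^{\mathsf{e2e}\text{-}T}(x)\big)\le\varepsilon$. The rule $A$ *implements $\mathrm{Cons}_{\mathsf{e2e}}$* if on every sample that is consistent with some member of $\mathsf{e2e}^T(\mathcal F)$ it returns $\hat f^{\mathsf{e2e}\text{-}T}$ for some $\hat f\in\mathcal F$ such that $\hat f^{\mathsf{e2e}\text{-}T}$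 is consistent with the sample. **Theorem.** 1. Let $\Sigma=\{0,1\}$, $\mathcal F\subseteq\Sigma^{\Sigma^*}$ and $T\ge 2$. Then $$\mathrm{VCdim}(\mathsf{e2e}^T(\mathcal F))\le 10\,\mathrm{Ldim}(\mathcal F)\,\log T .$$ 2. Let $\Sigma=\{0,\dots,k-1\}$, $\mathcal F\subseteq\Sigma^{\Sigma^*}$ and $T\ge 1$. Then $$\mathrm{Ndim}(\mathsf{e2e}^T(\mathcal F))\le 20\,\mathrm{sfat}_1(\mathcal F)\,\log (T|\Sigma|) .$$ 3. Let $\Sigma=\{0,1\}$. For every $\varepsilon_0\in(0,1)$ there is a constant $C>0$, depending only on $\varepsilon_0$, such that for every $\mathcal F\subseteq\Sigma^{\Sigma^*}$ with $\mathrm{Ldim}(\mathcal F)<\infty$ and every $T\ge 2$ there is a function $m:(0,1)^2\to\mathbb N$ with the following properties: there are rules that implement $\mathrm{Cons}_{\mathsf{e2e}}$; each of them learns $\mathsf{e2e}^T(\mathcal F)$ end-to-end with sample complexity $m$; and $$m(\varepsilon,\delta)\le C\,\varepsilon^{-1}\Big(\mathrm{Ldim}(\mathcal F)\,\log T\,\log(\varepsilon^{-1})+\log(\delta^{-1})\Big)\qquad(0<\varepsilon\le\varepsilon_0,\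 0<\delta<1).$$ -/

import Mathlib

open scoped ENNReal
open MeasureTheory

namespace AutoregressiveCoT

/-! ### Autoregressive generation -/

section Generation

variable {A : Type*}

/-- The apply-and-append map `x ↦ append(x, f(x))` of a next-token generator `f`. -/
def applyAppend (f : List A → A) (x : List A) : List A := x ++ [f x]

/-- The `T`-step chain of thought: `applyAppend f` iterated `T` times. -/
def cot (f : List A → A) (T : ℕ) (x : List A) : List A := (applyAppend f)^[T] x

/-- The end-to-end map: the last token of the `T`-step chain of thought. For `T ≥ 1` the chain of
thought is a nonempty string and the default value `f x` of `getLastD` plays no role. -/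
def e2e (f : List A → A) (T : ℕ) (x : List A) : A := (cot f T x).getLastD (f x)

/-- The end-to-end class of a base class `F`. -/
def e2eClass (F : Set (List A → A)) (T : ℕ) : Set (List A → A) := (fun f => e2e f T) '' F

end Generation

/-! ### Dimensions -/

section Dimensions

variable {X Y : Type*}

/-- `H(S)`: the behaviors of the class `H` on the points `S 0, …, S (m - 1)`. -/
def behaviors (H : Set (X → Y)) {m : ℕ} (S : Fin m → X) : Set (Fin m → Y) :=
  (fun h i => h (S i)) '' H

/-- `H` shatters the tuple `S` of length `m` if it has `2 ^ m` behaviors on it. -/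
def Shatters (H : Set (X → Bool)) {m : ℕ} (S : Fin m → X) : Prop :=
  (behaviors H S).ncard = 2 ^ m

/-- The Vapnik-Chervonenkis dimension: the largest length of a shattered tuple (`⊤` if there are
arbitrarily long ones). -/
noncomputable def vcDim (H : Set (X → Bool)) : ℕ∞ :=
  ⨆ (m : ℕ) (_ : ∃ S : Fin m → X, Shatters H S), (m : ℕ∞)

/-- An `X`-labeled complete binary tree of depth `d`: the node reached from the root by a path of
length `i < d` carries a label. -/
abbrev LabeledTree (X : Type*) (d : ℕ) := ∀ i : Fin d, (Fin i → Bool) → X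

/-- The label that the tree `x` carries at level `i` on the path `ε`. -/
def LabeledTree.label {d : ℕ} (x : LabeledTree X d) (ε : Fin d → Bool) (i : Fin d) : X :=
  x i fun j => ε (Fin.castLE i.isLt.le j)

/-- `H` shatters the tree `x`: every path is realized by some member of `H`. -/
def ShattersTree (H : Set (X → Bool)) {d : ℕ} (x : LabeledTree X d) : Prop :=
  ∀ ε : Fin d → Bool, ∃ h ∈ H, ∀ i, h (x.label ε i) = ε i

/-- The Littlestone dimension: the largest depth of a shattered tree. -/
noncomputable def ldim (H : Set (X → Bool)) : ℕ∞ :=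
  ⨆ (d : ℕ) (_ : ∃ x : LabeledTree X d, ShattersTree H x), (d : ℕ∞)

/-- Natarajan shattering of a finite set of points. -/
def NatarajanShatters (H : Set (X → Y)) (S : Finset X) : Prop :=
  ∃ h₀ h₁ : X → Y, (∀ x ∈ S, h₀ x ≠ h₁ x) ∧
    ∀ U ⊆ S, ∃ h ∈ H, (∀ x ∈ U, h x = h₀ x) ∧ ∀ x ∈ S, x ∉ U → h x = h₁ x

/-- The Natarajan dimension: the largest cardinality of a Natarajan-shattered set. -/
noncomputable def natarajanDim (H : Set (X → Y)) : ℕ∞ :=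
  ⨆ (S : Finset X) (_ : NatarajanShatters H S), (S.card : ℕ∞)

/-- `G` sequentially shatters the tree `x` at scale `α`, with some real witness tree `s`. The sign
`ε i ∈ {-1, 1}` is coded by a Boolean. -/
def SeqFatShatters (α : ℝ) (G : Set (X → ℝ)) {d : ℕ} (x : LabeledTree X d) : Prop :=
  ∃ s : LabeledTree ℝ d, ∀ ε : Fin d → Bool, ∃ g ∈ G, ∀ i,
    α / 2 ≤ (if ε i then (1 : ℝ) else -1) * (g (x.label ε i) - s.label ε i)

/-- The sequential fat-shattering dimension at scale `α`. -/
noncomputable def sfatDim (α : ℝ) (G : Set (X → ℝ)) : ℕ∞ :=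
  ⨆ (d : ℕ) (_ : ∃ x : LabeledTree X d, SeqFatShatters α G x), (d : ℕ∞)

/-- A class with values in `{0, …, k - 1}`, read as a class of real-valued functions. -/
def realClass {k : ℕ} (F : Set (X → Fin k)) : Set (X → ℝ) :=
  (fun f x => (((f x : Fin k) : ℕ) : ℝ)) '' F

end Dimensions

/-! ### End-to-end learning over the binary alphabet -/

section Learning

/-- The countable set of binary strings carries the discrete σ-algebra. -/
instance : MeasurableSpace (List Bool) := ⊤

/-- A learning rule maps finite labeled samples to predictors. -/
abbrev LearningRule := List (List Bool × Bool) → List Bool → Bool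

/-- The population 0-1 error of the predictor `h` when `D` is the input distribution and the
labels are given by `e2e f T`. -/
noncomputable def popError (D : Measure (List Bool)) (f : List Bool → Bool) (T : ℕ)
    (h : List Bool → Bool) : ℝ :=
  D.real {x | h x ≠ e2e f T x}

/-- The training sample of prompts `x 0, …, x (n - 1)`, labeled by `e2e f T`. -/
def e2eSample (f : List Bool → Bool) (T : ℕ) {n : ℕ} (x : Fin n → List Bool) :
    List (List Bool × Bool) :=
  List.ofFn fun i => (x i, e2e f T (x i))

/-- The rule `R` learns `e2eClass F T` end-to-end with sample complexity `m(ε, δ)`. -/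
def E2ELearns (F : Set (List Bool → Bool)) (T : ℕ) (R : LearningRule) (m : ℝ → ℝ → ℕ) : Prop :=
  ∀ (D : Measure (List Bool)) [IsProbabilityMeasure D], ∀ f ∈ F, ∀ ε δ : ℝ,
    0 < ε → ε < 1 → 0 < δ → δ < 1 →
      1 - δ ≤ (Measure.pi fun _ : Fin (m ε δ) => D).real
        {x | popError D f T (R (e2eSample f T x)) ≤ ε}

/-- `R` implements the end-to-end consistency rule: on every sample that some member of
`e2eClass F T` fits, it returns `e2e f T` for some `f ∈ F` that fits the sample. -/
def IsConsE2E (F : Set (List Bool → Bool)) (T : ℕ) (R : LearningRule) : Prop :=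
  ∀ S : List (List Bool × Bool), (∃ f ∈ F, ∀ p ∈ S, e2e f T p.1 = p.2) →
    ∃ f ∈ F, R S = e2e f T ∧ ∀ p ∈ S, e2e f T p.1 = p.2

end Learning

end AutoregressiveCoT

open AutoregressiveCoT

/-! One end-to-end label costs `T` adaptive evaluations of `f`, so the labels of `m` prompts form a
decision tree of depth `m * T` that queries `f`. If each node of a mistake tree carries two distinct
edge labels and `F` shatters no such tree of depth `d + 1`, then at each query at most one answer
leaves a subclass that still shatters depth `d`. Induction on the number of queries gives a
Sauer-Shelah bound on the number of outcomes (`QueryComputable.ncard_image_le`), polynomial in `m *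
T` with exponent the dimension. These trees are Littlestone trees over `Bool`, and shattered trees
at scale 1 over `Fin k`.

Parts 1 and 2 follow because a shattered set of size `m` has at least `2 ^ m` behaviors. Part 3
feeds the same count, on double samples, into a symmetrization argument. Random swaps bound the
expected largest weight of a hypothesis that is correct on the first half by the number of
behaviors, whereas a consistent hypothesis of error at least `ε` forces this expectation over the
second half up to `(1 + ε) ^ m`. The ratio bounds the failure probability
(`measure_exists_consistent_mul_le`), uniformly over all consistency rules. -/

namespace AutoregressiveCoT

/-! ### Adaptive query complexity of the end-to-end map. -/

section Queries

variable {X Y Z W : Type*}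

/-- `φ f` can be computed by `n` adaptive evaluations of `f`. -/
inductive QueryComputable : ℕ → ((X → Y) → Z) → Prop
  | const (z : Z) : QueryComputable 0 fun _ => z
  | query {n : ℕ} (x : X) (φ : Y → (X → Y) → Z) (h : ∀ y, QueryComputable n (φ y)) :
      QueryComputable (n + 1) fun f => φ (f x) f

theorem QueryComputable.bind {n m : ℕ} {φ : (X → Y) → Z} (hφ : QueryComputable n φ)
    {ψ : Z → (X → Y) → W} (hψ : ∀ z, QueryComputable m (ψ z)) :
    QueryComputable (n + m) fun f => ψ (φ f) f := by
  induction hφ with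
  | const z => simpa using hψ z
  | @query n x φ h ih =>
    rw [Nat.add_right_comm]
    exact QueryComputable.query x (fun y f => ψ (φ y f) f) ih

theorem QueryComputable.map {n : ℕ} {φ : (X → Y) → Z} (hφ : QueryComputable n φ) (g : Z → W) :
    QueryComputable n fun f => g (φ f) :=
  hφ.bind (m := 0) (ψ := fun z _ => g z) fun z => .const (g z)

/-- Finiteness is needed later because `Set.ncard` is zero on infinite sets, so comparisons of
cardinalities would fail without it. -/
theorem QueryComputable.finite_range [Finite Y] {n : ℕ} {φ : (X → Y) → Z}
    (hφ : QueryComputable n φ) : (Set.range φ).Finite := by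
  induction hφ with
  | const z => exact (Set.finite_singleton z).subset (by rintro _ ⟨f, rfl⟩; rfl)
  | query x φ h ih =>
    refine (Set.finite_iUnion ih).subset ?_
    rintro _ ⟨f, rfl⟩
    exact Set.mem_iUnion.2 ⟨f x, f, rfl⟩

theorem queryComputable_cot (T : ℕ) (x : List Y) :
    QueryComputable T fun f : List Y → Y => cot f T x := by
  induction T generalizing x with
  | zero => exact .const x
  | succ T ih => exact .query x (fun y f => cot f T (x ++ [y])) fun y => ih _

/-- Replacing the default `f x` by a constant spares one query, so that `T` queries suffice. -/
theorem e2e_eq_getLastD_cot {T : ℕ} (hT : 1 ≤ T) (f : List Y → Y) (x : List Y) (y : Y) :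
    e2e f T x = (cot f T x).getLastD y := by
  obtain ⟨T, rfl⟩ := Nat.exists_eq_add_of_le' hT
  simp [e2e, cot, Function.iterate_succ_apply', applyAppend]

theorem queryComputable_e2e [Nonempty Y] {T : ℕ} (hT : 1 ≤ T) (x : List Y) :
    QueryComputable T fun f : List Y → Y => e2e f T x := by
  have y : Y := Classical.arbitrary Y
  simp_rw [fun f => e2e_eq_getLastD_cot hT f x y]
  exact (queryComputable_cot T x).map fun l => l.getLastD y

theorem QueryComputable.pi {T : ℕ} {ψ : W → (X → Y) → Z} (h : ∀ w, QueryComputable T (ψ w))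
    {m : ℕ} (S : Fin m → W) :
    QueryComputable (m * T) fun f : X → Y => fun i => ψ (S i) f := by
  induction m with
  | zero =>
    rw [Nat.zero_mul]
    convert QueryComputable.const (X := X) (Y := Y) (Z := Fin 0 → Z) Fin.elim0 using 2
  | succ m ih =>
    have key := (ih fun i => S i.succ).bind (m := T)
      (ψ := fun v f => (Fin.cons (ψ (S 0) f) v : Fin (m + 1) → Z))
      fun v => (h (S 0)).map fun z => (Fin.cons z v : Fin (m + 1) → Z)
    rw [Nat.succ_mul]
    convert key using 2
    exact (Fin.cons_self_tail _).symm

end Queries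

/-! ### Counting outcomes by the Littlestone dimension. -/

section Littlestone

variable {X Y Z : Type*}

/-- `F` shatters a tree of depth `d` in which each edge carries one of two distinct labels that
depend on its upper node. -/
def LittlestoneShatters : ℕ → Set (X → Y) → Prop
  | 0, F => F.Nonempty
  | d + 1, F => ∃ (x : X) (y₀ y₁ : Y), y₀ ≠ y₁ ∧
      LittlestoneShatters d {f ∈ F | f x = y₀} ∧ LittlestoneShatters d {f ∈ F | f x = y₁}

theorem LittlestoneShatters.mono {d : ℕ} {F G : Set (X → Y)} (h : LittlestoneShatters d F)
    (hFG : F ⊆ G) : LittlestoneShatters d G := by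
  induction d generalizing F G with
  | zero => exact Set.Nonempty.mono hFG h
  | succ d ih =>
    obtain ⟨x, y₀, y₁, hne, h₀, h₁⟩ := h
    exact ⟨x, y₀, y₁, hne, ih h₀ fun f hf => ⟨hFG hf.1, hf.2⟩, ih h₁ fun f hf => ⟨hFG hf.1, hf.2⟩⟩

/-- The Sauer-Shelah type sum that bounds the number of behaviors. -/
def sauerSum (K n d : ℕ) : ℕ := ∑ i ∈ Finset.range d, n.choose i * K ^ i

theorem sauerSum_succ (K n d : ℕ) :
    sauerSum K (n + 1) (d + 1) = sauerSum K n (d + 1) + K * sauerSum K n d := by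
  simp only [sauerSum]
  rw [Finset.sum_range_succ', Finset.sum_range_succ' _ d, Finset.mul_sum, add_right_comm,
    ← Finset.sum_add_distrib]
  congr 1
  · refine Finset.sum_congr rfl fun i _ => ?_
    rw [Nat.choose_succ_succ]
    ring
  · simp

/-- Split `F` by the answer to the first query. All answers but one lower the admissible depth, and
there are at most `K` of these, which matches the Pascal-type recursion `sauerSum_succ`. -/
theorem QueryComputable.ncard_image_le [Fintype Y] {K : ℕ} (hK : Fintype.card Y ≤ K + 1)
    {n : ℕ} {φ : (X → Y) → Z} (hφ : QueryComputable n φ) {d : ℕ} {F : Set (X → Y)}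
    (hF : ¬ LittlestoneShatters d F) : (φ '' F).ncard ≤ sauerSum K n d := by
  classical
  induction hφ generalizing d F with
  | const z =>
    cases d with
    | zero => simp [Set.not_nonempty_iff_eq_empty.1 hF]
    | succ d =>
      have h1 : ((fun _ : X → Y => z) '' F).ncard ≤ 1 := by
        rw [← Set.ncard_singleton z]
        exact Set.ncard_le_ncard (by rintro _ ⟨f, _, rfl⟩; rfl)
      refine h1.trans ?_
      simp [sauerSum, Finset.sum_range_succ']
  | @query n x φ h ih =>
    rcases F.eq_empty_or_nonempty with rfl | ⟨f₀, hf₀⟩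
    · simp
    cases d with
    | zero => exact absurd ⟨f₀, hf₀⟩ hF
    | succ d =>
      -- Two distinct answers that both keep depth `d` would make `x` the root of a shattered tree
      -- of depth `d + 1`. If no answer keeps it, any `y'` serves.
      obtain ⟨y', hy'⟩ : ∃ y', ∀ y ≠ y', ¬ LittlestoneShatters d {f ∈ F | f x = y} := by
        by_cases hex : ∃ y', LittlestoneShatters d {f ∈ F | f x = y'}
        · obtain ⟨y', hy'⟩ := hex
          exact ⟨y', fun y hy hsh => hF ⟨x, y, y', hy, hsh, hy'⟩⟩
        · push Not at hex
          exact ⟨f₀ x, fun y _ => hex y⟩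
      have hsub : (fun f => φ (f x) f) '' F ⊆ ⋃ y, φ y '' {f ∈ F | f x = y} := by
        rintro _ ⟨f, hf, rfl⟩
        exact Set.mem_iUnion.2 ⟨f x, f, ⟨hf, rfl⟩, rfl⟩
      have hfin : ∀ y, (φ y '' {f ∈ F | f x = y}).Finite := fun y =>
        (h y).finite_range.subset (Set.image_subset_range _ _)
      calc ((fun f => φ (f x) f) '' F).ncard
          ≤ (⋃ y, φ y '' {f ∈ F | f x = y}).ncard :=
            Set.ncard_le_ncard hsub (Set.finite_iUnion hfin)
        _ ≤ ∑ y, (φ y '' {f ∈ F | f x = y}).ncard := Set.ncard_iUnion_le_of_fintype _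
        _ = (φ y' '' {f ∈ F | f x = y'}).ncard +
            ∑ y ∈ Finset.univ.erase y', (φ y '' {f ∈ F | f x = y}).ncard :=
            (Finset.add_sum_erase _ _ (Finset.mem_univ y')).symm
        _ ≤ sauerSum K n (d + 1) + ∑ y ∈ Finset.univ.erase y', sauerSum K n d := by
            refine Nat.add_le_add (ih y' fun hsh => hF (hsh.mono fun f hf => hf.1))
              (Finset.sum_le_sum fun y hy => ih y (hy' y (Finset.ne_of_mem_erase hy)))
        _ ≤ sauerSum K n (d + 1) + K * sauerSum K n d := by
            rw [Finset.sum_const, Finset.card_erase_of_mem (Finset.mem_univ _), smul_eq_mul,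
              Finset.card_univ]
            gcongr
            omega
        _ = sauerSum K (n + 1) (d + 1) := (sauerSum_succ K n d).symm

/-- The tree with a given root label and given left and right subtrees. -/
def LabeledTree.node {d : ℕ} (a : X) (t : Bool → LabeledTree X d) : LabeledTree X (d + 1) :=
  fun i => Fin.cases (motive := fun i : Fin (d + 1) => (Fin i → Bool) → X) (fun _ => a)
    (fun j p => t (p ⟨0, Nat.succ_pos j⟩) j fun l => p ⟨l + 1, Nat.succ_lt_succ l.isLt⟩) i

theorem LabeledTree.label_node_zero {d : ℕ} (a : X) (t : Bool → LabeledTree X d)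
    (ε : Fin (d + 1) → Bool) : (LabeledTree.node a t).label ε 0 = a := rfl

theorem LittlestoneShatters.exists_shattersTree {d : ℕ} {F : Set (X → Bool)}
    (h : LittlestoneShatters d F) : ∃ x : LabeledTree X d, ShattersTree F x := by
  induction d generalizing F with
  | zero =>
    obtain ⟨f, hf⟩ := h
    exact ⟨fun i => i.elim0, fun ε => ⟨f, hf, fun i => i.elim0⟩⟩
  | succ d ih =>
    obtain ⟨x, y₀, y₁, hne, h₀, h₁⟩ := h
    have hb : ∀ b, LittlestoneShatters d {f ∈ F | f x = b} := by
      intro b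
      cases b <;> cases y₀ <;> cases y₁ <;> first | assumption | exact absurd rfl hne
    choose t ht using fun b => ih (hb b)
    refine ⟨LabeledTree.node x t, fun ε => ?_⟩
    obtain ⟨f, ⟨hf, hfx⟩, hfi⟩ := ht (ε 0) fun j => ε j.succ
    exact ⟨f, hf, Fin.cases hfx hfi⟩

/-- Distinct labels in `Fin k` differ by at least 1, so their midpoint is a threshold with margin
one half on both sides. -/
theorem LittlestoneShatters.exists_seqFatShatters {k d : ℕ} {F : Set (X → Fin k)}
    (h : LittlestoneShatters d F) : ∃ x : LabeledTree X d, SeqFatShatters 1 (realClass F) x := by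
  suffices ∃ (x : LabeledTree X d) (s : LabeledTree ℝ d), ∀ ε : Fin d → Bool, ∃ f ∈ F, ∀ i,
      (1 : ℝ) / 2 ≤ (if ε i then (1 : ℝ) else -1) *
        (((f (x.label ε i) : Fin k) : ℕ) - s.label ε i) by
    obtain ⟨x, s, hs⟩ := this
    refine ⟨x, s, fun ε => ?_⟩
    obtain ⟨f, hf, hfi⟩ := hs ε
    exact ⟨_, ⟨f, hf, rfl⟩, hfi⟩
  induction d generalizing F with
  | zero =>
    obtain ⟨f, hf⟩ := h
    exact ⟨fun i => i.elim0, fun i => i.elim0, fun ε => ⟨f, hf, fun i => i.elim0⟩⟩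
  | succ d ih =>
    obtain ⟨x, y₀, y₁, hlt, h₀, h₁⟩ : ∃ (x : X) (y₀ y₁ : Fin k), y₀ < y₁ ∧
        LittlestoneShatters d {f ∈ F | f x = y₀} ∧ LittlestoneShatters d {f ∈ F | f x = y₁} := by
      obtain ⟨x, y₀, y₁, hne, h₀, h₁⟩ := h
      rcases lt_or_gt_of_ne hne with hlt | hlt
      exacts [⟨x, y₀, y₁, hlt, h₀, h₁⟩, ⟨x, y₁, y₀, hlt, h₁, h₀⟩]
    have hb : ∀ b : Bool, LittlestoneShatters d {f ∈ F | f x = if b then y₁ else y₀} := by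
      rintro (_ | _) <;> simpa
    choose t s hts using fun b => ih (hb b)
    refine ⟨LabeledTree.node x t, LabeledTree.node (((y₀ : ℕ) + (y₁ : ℕ)) / 2 : ℝ) s,
      fun ε => ?_⟩
    obtain ⟨f, ⟨hf, hfx⟩, hfi⟩ := hts (ε 0) fun j => ε j.succ
    refine ⟨f, hf, Fin.cases ?_ hfi⟩
    have hlt' : ((y₀ : ℕ) : ℝ) + 1 ≤ ((y₁ : ℕ) : ℝ) := by exact_mod_cast hlt
    rw [LabeledTree.label_node_zero, LabeledTree.label_node_zero, hfx]
    cases ε 0 <;> simp <;> linarith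

theorem not_littlestoneShatters_of_ldim {F : Set (X → Bool)} {d : ℕ} (hd : ldim F = d) :
    ¬ LittlestoneShatters (d + 1) F := by
  intro h
  have h1 : ((d + 1 : ℕ) : ℕ∞) ≤ ldim F :=
    le_iSup₂ (f := fun (d : ℕ) (_ : ∃ x : LabeledTree X d, ShattersTree F x) => (d : ℕ∞))
      (d + 1) h.exists_shattersTree
  rw [hd, Nat.cast_le] at h1
  omega

theorem not_littlestoneShatters_of_sfatDim {k : ℕ} {F : Set (X → Fin k)} {d : ℕ}
    (hd : sfatDim 1 (realClass F) = d) : ¬ LittlestoneShatters (d + 1) F := by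
  intro h
  have h1 : ((d + 1 : ℕ) : ℕ∞) ≤ sfatDim 1 (realClass F) :=
    le_iSup₂ (f := fun (d : ℕ) (_ : ∃ x : LabeledTree X d, SeqFatShatters 1 (realClass F) x) =>
      (d : ℕ∞)) (d + 1) h.exists_seqFatShatters
  rw [hd, Nat.cast_le] at h1
  omega

end Littlestone

/-! ### Numerical consequences of the Sauer-Shelah sum. -/

section Bounds

/-- With `r = n * K / d ≥ 1`, the `i`-th term is at most `r ^ i * d ^ i / i!`. Raising `r ^ i` to `r
^ d` leaves a partial sum of the series of `exp d`. -/
theorem sauerSum_le {K n d : ℕ} (hd : 1 ≤ d) (hdn : (d : ℝ) ≤ n * K) :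
    (sauerSum K n (d + 1) : ℝ) ≤ (Real.exp 1 * (n * K / d)) ^ d := by
  have hd0 : (0 : ℝ) < d := by exact_mod_cast hd
  have hone : (1 : ℝ) ≤ n * K / d := by rwa [one_le_div hd0]
  have hterm : ∀ i ∈ Finset.range (d + 1), ((n.choose i * K ^ i : ℕ) : ℝ) ≤
      ((n : ℝ) * K / d) ^ d * ((d : ℝ) ^ i / (i.factorial : ℝ)) := by
    intro i hi
    have hi' : i ≤ d := Nat.lt_succ_iff.1 (Finset.mem_range.1 hi)
    have h1 : ((n.choose i : ℕ) : ℝ) ≤ (n : ℝ) ^ i / (i.factorial : ℝ) :=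
      Nat.choose_le_pow_div i n
    have hfac : (0 : ℝ) < i.factorial := by exact_mod_cast i.factorial_pos
    calc ((n.choose i * K ^ i : ℕ) : ℝ) = (n.choose i : ℝ) * (K : ℝ) ^ i := by push_cast; ring
      _ ≤ ((n : ℝ) ^ i / (i.factorial : ℝ)) * (K : ℝ) ^ i := by gcongr
      _ = ((n : ℝ) * K / d) ^ i * ((d : ℝ) ^ i / (i.factorial : ℝ)) := by
          rw [div_pow, mul_pow]; field_simp
      _ ≤ ((n : ℝ) * K / d) ^ d * ((d : ℝ) ^ i / (i.factorial : ℝ)) := by gcongr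
  calc (sauerSum K n (d + 1) : ℝ)
      = ∑ i ∈ Finset.range (d + 1), ((n.choose i * K ^ i : ℕ) : ℝ) := by
        rw [sauerSum, Nat.cast_sum]
    _ ≤ ∑ i ∈ Finset.range (d + 1), ((n : ℝ) * K / d) ^ d * ((d : ℝ) ^ i / (i.factorial : ℝ)) :=
        Finset.sum_le_sum hterm
    _ ≤ ((n : ℝ) * K / d) ^ d * Real.exp d := by
        rw [← Finset.mul_sum]
        gcongr
        exact Real.sum_le_exp_of_nonneg hd0.le _
    _ = (Real.exp 1 * (n * K / d)) ^ d := by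
        rw [mul_pow, ← Real.exp_nat_mul, mul_one, mul_comm]

theorem sauerSum_one (K n : ℕ) : sauerSum K n 1 = 1 := by simp [sauerSum]

theorem le_mul_log_of_two_pow_le_sauerSum {K T m d : ℕ} (hK : 1 ≤ K) (hT : 1 ≤ T) {M : ℝ}
    (hM : 2 ≤ M) (hTM : (T : ℝ) * K ≤ M) (h : 2 ^ m ≤ sauerSum K (m * T) (d + 1)) :
    (m : ℝ) ≤ 10 * d * Real.log M := by
  have hlog2 := Real.log_two_gt_d9
  have hL : Real.log 2 ≤ Real.log M := Real.log_le_log two_pos hM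
  rcases Nat.eq_zero_or_pos d with rfl | hd
  · rw [zero_add, sauerSum_one] at h
    rcases Nat.eq_zero_or_pos m with rfl | hm
    · simp
    · exact absurd h (not_le.2 (Nat.one_lt_two_pow hm.ne'))
  have hd0 : (0 : ℝ) < d := by exact_mod_cast hd
  rcases le_or_gt m d with hmd | hmd
  · have : (m : ℝ) ≤ d := by exact_mod_cast hmd
    nlinarith
  have hm0 : (0 : ℝ) < m := by exact_mod_cast hd.trans hmd
  have hT1 : (1 : ℝ) ≤ T := by exact_mod_cast hT
  have hK1 : (1 : ℝ) ≤ K := by exact_mod_cast hK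
  have hdn : (d : ℝ) ≤ ((m * T : ℕ) : ℝ) * K := by
    have : d ≤ m * T * K := by
      calc d ≤ m * 1 * 1 := by omega
        _ ≤ m * T * K := by gcongr
    exact_mod_cast this
  have h2 : (2 : ℝ) ^ m ≤ (Real.exp 1 * (((m * T : ℕ) : ℝ) * K / d)) ^ d := by
    refine le_trans ?_ (sauerSum_le hd hdn)
    exact_mod_cast h
  have h3 : (2 : ℝ) ^ m ≤ (Real.exp 1 * ((m / d) * M)) ^ d := by
    refine h2.trans ?_
    have : ((m * T : ℕ) : ℝ) * K / d = m / d * (T * K) := by push_cast; ring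
    rw [this]
    gcongr
  have h4 := Real.log_le_log (by positivity) h3
  have hr0 : (0 : ℝ) < m / d := by positivity
  rw [Real.log_pow, Real.log_pow, Real.log_mul (Real.exp_ne_zero _) (by positivity),
    Real.log_exp, Real.log_mul hr0.ne' (by positivity)] at h4
  -- The tangent to the logarithm at `e`. Its slope `1 / e < 0.37` is below `log 2`, so the term
  -- linear in `m` can be absorbed on the left.
  have h5 : Real.log (m / d) ≤ (m / d) / Real.exp 1 := by
    have := Real.log_le_sub_one_of_pos (x := (m / d) / Real.exp 1) (by positivity)
    rw [Real.log_div hr0.ne' (Real.exp_ne_zero _), Real.log_exp] at this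
    linarith
  have h6 : ((m : ℝ) / d) / Real.exp 1 ≤ (m / d) * 0.37 := by
    rw [div_le_iff₀ (Real.exp_pos 1)]
    have := Real.exp_one_gt_d9
    nlinarith
  have h7 : (d : ℝ) * (1 + (Real.log (m / d) + Real.log M)) ≤
      d * (1 + ((m / d) * 0.37 + Real.log M)) := by
    gcongr; exact h5.trans h6
  have h8 : (d : ℝ) * (1 + ((m / d) * 0.37 + Real.log M)) = d + m * 0.37 + d * Real.log M := by
    field_simp
    ring
  -- What remains is `m * (log 2 - 0.37) ≤ d + d * log M`. Bounding `d` by `d * log M / log 2` gives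
  -- a constant below 8.
  nlinarith [mul_le_mul_of_nonneg_left hL hd0.le]

/-- The counting hypothesis concerns finite `D` only; for `D = ⊤` the right side is infinite, since
`log M > 0`. -/
theorem natCast_le_of_two_pow_le_sauerSum {K T m : ℕ} {D : ℕ∞} (hK : 1 ≤ K) (hT : 1 ≤ T)
    {M c : ℝ} (hc : 10 ≤ c) (hM : 2 ≤ M) (hTM : (T : ℝ) * K ≤ M)
    (h : ∀ d : ℕ, D = d → 2 ^ m ≤ sauerSum K (m * T) (d + 1)) :
    (m : ℝ≥0∞) ≤ ENNReal.ofReal c * (D : ℝ≥0∞) * ENNReal.ofReal (Real.log M) := by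
  have hlog : 0 < Real.log M := Real.log_pos (by linarith)
  induction D using ENat.recTopCoe with
  | top =>
    have h1 : ENNReal.ofReal c ≠ 0 := (ENNReal.ofReal_pos.2 (by linarith)).ne'
    have h2 : ENNReal.ofReal (Real.log M) ≠ 0 := (ENNReal.ofReal_pos.2 hlog).ne'
    simp [ENNReal.mul_top h1, ENNReal.top_mul h2]
  | coe d =>
    have h1 := le_mul_log_of_two_pow_le_sauerSum hK hT hM hTM (h d rfl)
    have h2 : (m : ℝ) ≤ c * d * Real.log M := h1.trans (by gcongr)
    calc (m : ℝ≥0∞) = ENNReal.ofReal m := (ENNReal.ofReal_natCast m).symm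
      _ ≤ ENNReal.ofReal (c * d * Real.log M) := ENNReal.ofReal_le_ofReal h2
      _ = _ := by
        rw [ENNReal.ofReal_mul (by positivity), ENNReal.ofReal_mul (by linarith),
          ENNReal.ofReal_natCast]
        simp

end Bounds

/-! ### Dimension bounds for the end-to-end class. -/

section EndToEnd

variable {Y : Type*}

theorem behaviors_e2eClass (F : Set (List Y → Y)) (T : ℕ) {m : ℕ} (S : Fin m → List Y) :
    behaviors (e2eClass F T) S = (fun f i => e2e f T (S i)) '' F := by
  simp [behaviors, e2eClass, Set.image_image]

theorem finite_behaviors_e2eClass [Finite Y] [Nonempty Y] (F : Set (List Y → Y)) {T : ℕ}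
    (hT : 1 ≤ T) {m : ℕ} (S : Fin m → List Y) : (behaviors (e2eClass F T) S).Finite := by
  rw [behaviors_e2eClass]
  exact (QueryComputable.pi (ψ := fun x f => e2e f T x)
    (queryComputable_e2e hT) S).finite_range.subset (Set.image_subset_range _ _)

theorem ncard_behaviors_e2eClass_le [Fintype Y] [Nonempty Y] {K : ℕ}
    (hK : Fintype.card Y ≤ K + 1) {F : Set (List Y → Y)} {d : ℕ}
    (hF : ¬ LittlestoneShatters d F) {T : ℕ} (hT : 1 ≤ T) {m : ℕ} (S : Fin m → List Y) :
    (behaviors (e2eClass F T) S).ncard ≤ sauerSum K (m * T) d := by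
  rw [behaviors_e2eClass]
  exact (QueryComputable.pi (ψ := fun x f => e2e f T x)
    (queryComputable_e2e hT) S).ncard_image_le hK hF

theorem vcDim_e2eClass_le (F : Set (List Bool → Bool)) {T : ℕ} (hT : 2 ≤ T) :
    (vcDim (e2eClass F T) : ℝ≥0∞) ≤ 10 * (ldim F : ℝ≥0∞) * ENNReal.ofReal (Real.log T) := by
  suffices ∀ m : ℕ, (∃ S : Fin m → List Bool, Shatters (e2eClass F T) S) →
      (m : ℝ≥0∞) ≤ 10 * (ldim F : ℝ≥0∞) * ENNReal.ofReal (Real.log T) by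
    simpa [vcDim, ENat.toENNReal_iSup] using this
  rintro m ⟨S, hS⟩
  have h := natCast_le_of_two_pow_le_sauerSum (K := 1) (T := T) (m := m) (D := ldim F) (M := T)
    (c := 10) le_rfl (by omega) le_rfl (by exact_mod_cast hT) (by simp) fun d hd => by
      rw [← hS]
      exact ncard_behaviors_e2eClass_le (by simp) (not_littlestoneShatters_of_ldim hd)
        (by omega) S
  simpa using h

/-- Each subset `U` yields the behavior that equals `h₀` on `U` and `h₁` off `U`. As `h₀` and `h₁`
differ throughout `S`, the behavior determines `U`. -/
theorem NatarajanShatters.two_pow_le {X : Type*} {H : Set (X → Y)} {S : Finset X}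
    (h : NatarajanShatters H S) (hfin : (behaviors H fun i => (S.equivFin.symm i : X)).Finite) :
    2 ^ S.card ≤ (behaviors H fun i => (S.equivFin.symm i : X)).ncard := by
  classical
  obtain ⟨h₀, h₁, hne, hU⟩ := h
  let v : Finset X → Fin S.card → Y := fun U i =>
    if (S.equivFin.symm i : X) ∈ U then h₀ (S.equivFin.symm i) else h₁ (S.equivFin.symm i)
  have hsub : v '' (S.powerset : Set (Finset X)) ⊆
      behaviors H fun i => (S.equivFin.symm i : X) := by
    rintro _ ⟨U, hUS, rfl⟩
    obtain ⟨g, hg, hg0, hg1⟩ := hU U (Finset.mem_powerset.1 hUS)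
    refine ⟨g, hg, funext fun i => ?_⟩
    by_cases hi : (S.equivFin.symm i : X) ∈ U
    · simp [v, hi, hg0 _ hi]
    · simp [v, hi, hg1 _ (S.equivFin.symm i).2 hi]
  have hinj : Set.InjOn v (S.powerset : Set (Finset X)) := by
    intro U hUS V hVS huv
    have hU' := Finset.mem_powerset.1 hUS
    have hV' := Finset.mem_powerset.1 hVS
    have key : ∀ x ∈ S, (x ∈ U ↔ x ∈ V) := by
      intro x hx
      have := congrFun huv (S.equivFin ⟨x, hx⟩)
      have hx' := hne x hx
      by_cases h1 : x ∈ U <;> by_cases h2 : x ∈ V <;>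
        simp_all [v, eq_comm]
    ext x
    exact ⟨fun hx => (key x (hU' hx)).1 hx, fun hx => (key x (hV' hx)).2 hx⟩
  calc 2 ^ S.card = (S.powerset : Set (Finset X)).ncard := by
        rw [Set.ncard_coe_finset, Finset.card_powerset]
    _ = (v '' (S.powerset : Set (Finset X))).ncard := hinj.ncard_image.symm
    _ ≤ _ := Set.ncard_le_ncard hsub hfin

theorem natarajanDim_e2eClass_le {k : ℕ} (F : Set (List (Fin k) → Fin k)) {T : ℕ} (hT : 1 ≤ T) :
    (natarajanDim (e2eClass F T) : ℝ≥0∞) ≤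
      20 * (sfatDim 1 (realClass F) : ℝ≥0∞) * ENNReal.ofReal (Real.log ((T : ℝ) * k)) := by
  suffices ∀ S : Finset (List (Fin k)), NatarajanShatters (e2eClass F T) S →
      (S.card : ℝ≥0∞) ≤
        20 * (sfatDim 1 (realClass F) : ℝ≥0∞) * ENNReal.ofReal (Real.log ((T : ℝ) * k)) by
    simpa [natarajanDim, ENat.toENNReal_iSup] using this
  intro S hS
  -- For `k < 2` the numerical lemma does not apply, but without two distinct labels only the empty
  -- set is shattered.
  rcases lt_or_ge k 2 with hk | hk
  · have hsub : Subsingleton (Fin k) := Fin.subsingleton_iff_le_one.2 (by omega)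
    have hS0 : S = ∅ := by
      obtain ⟨h₀, h₁, hne, -⟩ := hS
      exact Finset.eq_empty_of_forall_notMem fun x hx => hne x hx (Subsingleton.elim _ _)
    simp [hS0]
  · have : NeZero k := ⟨by omega⟩
    have hT1 : (1 : ℝ) ≤ T := by exact_mod_cast hT
    have hk2 : (2 : ℝ) ≤ k := by exact_mod_cast hk
    have h := natCast_le_of_two_pow_le_sauerSum (K := k - 1) (T := T) (m := S.card)
      (D := sfatDim 1 (realClass F)) (M := T * k) (c := 20) (by omega) hT (by norm_num)
      (by nlinarith) (by gcongr; exact k.sub_le 1) fun d hd =>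
        (hS.two_pow_le (finite_behaviors_e2eClass F hT _)).trans
          (ncard_behaviors_e2eClass_le (by simp; omega) (not_littlestoneShatters_of_sfatDim hd)
            hT _)
    simpa using h

end EndToEnd

/-! ### Symmetrization with multiplicative weights. -/

section Symmetrization

variable {X Y : Type*}

open scoped Classical in
/-- The weight that a pair of predictions `u` receives for the pair of labels `v`: zero if the
first prediction is wrong, otherwise `2` or `1` according to whether the second one is wrong. -/
noncomputable def pairWeight (u v : Y × Y) : ℝ≥0∞ :=
  if u.1 = v.1 then (if u.2 = v.2 then 1 else 2) else 0

/-- Swap the two components of a pair if the given bit is set. -/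
def condSwap (b : Bool) (u : X × X) : X × X := if b then u.swap else u

theorem map_condSwap (h : X → Y) (b : Bool) (u : X × X) :
    Prod.map h h (condSwap b u) = condSwap b (Prod.map h h u) := by
  cases b <;> rfl

/-- The values 1, 2, 0 are chosen so that a random swap has mean weight at most 1: the two orders
give `1 + 1`, `2 + 0` or `0 + 0` according to whether none, one or both predictions are wrong. -/
theorem sum_pairWeight_condSwap_le (u v : Y × Y) :
    ∑ b : Bool, pairWeight (condSwap b u) (condSwap b v) ≤ 2 := by
  by_cases h1 : u.1 = v.1 <;> by_cases h2 : u.2 = v.2 <;>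
    simp [pairWeight, condSwap, h1, h2, one_add_one_eq_two]

theorem sum_prod_pairWeight_condSwap_le {m : ℕ} (u v : Fin m → Y × Y) :
    ∑ σ : Fin m → Bool, ∏ i, pairWeight (condSwap (σ i) (u i)) (condSwap (σ i) (v i)) ≤ 2 ^ m := by
  have h := Finset.prod_univ_sum (fun _ : Fin m => (Finset.univ : Finset Bool))
    fun i b => pairWeight (condSwap b (u i)) (condSwap b (v i))
  rw [Fintype.piFinset_univ] at h
  rw [← h]
  calc _ ≤ ∏ _i : Fin m, (2 : ℝ≥0∞) :=
        Finset.prod_le_prod' fun i _ => sum_pairWeight_condSwap_le (u i) (v i)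
    _ = 2 ^ m := by simp

/-- The largest weight that a member of `H` which is correct on the first half of the double
sample `z` receives. -/
noncomputable def doubleSampleWeight (H : Set (X → Y)) (c : X → Y) {m : ℕ} (z : Fin m → X × X) :
    ℝ≥0∞ :=
  ⨆ h ∈ H, ∏ i, pairWeight (Prod.map h h (z i)) (Prod.map c c (z i))

/-- Swapping the sample only swaps predictions, so the same at most `N` behaviors on `z` serve for
every `σ`. The supremum is at most the sum over them, a union bound. -/
theorem sum_doubleSampleWeight_condSwap_le {H : Set (X → Y)} {c : X → Y} {m N : ℕ}
    (z : Fin m → X × X)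
    (hfin : ((fun (h : X → Y) i => Prod.map h h (z i)) '' H).Finite)
    (hN : ((fun (h : X → Y) i => Prod.map h h (z i)) '' H).ncard ≤ N) :
    ∑ σ : Fin m → Bool, doubleSampleWeight H c (fun i => condSwap (σ i) (z i)) ≤ N * 2 ^ m := by
  have hle : ∀ σ : Fin m → Bool, doubleSampleWeight H c (fun i => condSwap (σ i) (z i)) ≤
      ∑ u ∈ hfin.toFinset,
        ∏ i, pairWeight (condSwap (σ i) (u i)) (condSwap (σ i) (Prod.map c c (z i))) := by
    intro σ
    refine iSup₂_le fun h hh => ?_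
    simp_rw [map_condSwap]
    exact Finset.single_le_sum (f := fun u : Fin m → Y × Y =>
      ∏ i, pairWeight (condSwap (σ i) (u i)) (condSwap (σ i) (Prod.map c c (z i))))
      (fun _ _ => zero_le) (hfin.mem_toFinset.2 ⟨h, hh, rfl⟩)
  calc _ ≤ ∑ σ : Fin m → Bool, ∑ u ∈ hfin.toFinset,
        ∏ i, pairWeight (condSwap (σ i) (u i)) (condSwap (σ i) (Prod.map c c (z i))) :=
        Finset.sum_le_sum fun σ _ => hle σ
    _ = ∑ u ∈ hfin.toFinset, ∑ σ : Fin m → Bool,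
        ∏ i, pairWeight (condSwap (σ i) (u i)) (condSwap (σ i) (Prod.map c c (z i))) :=
        Finset.sum_comm
    _ ≤ ∑ u ∈ hfin.toFinset, 2 ^ m :=
        Finset.sum_le_sum fun u _ => sum_prod_pairWeight_condSwap_le _ _
    _ ≤ N * 2 ^ m := by
        rw [Finset.sum_const, nsmul_eq_mul, ← Set.ncard_eq_toFinset_card _ hfin]
        gcongr

variable [MeasurableSpace X]

theorem measurePreserving_condSwap (D : Measure X) [SFinite D] (b : Bool) :
    MeasurePreserving (condSwap b) (D.prod D) (D.prod D) := by
  cases b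
  · exact MeasurePreserving.id _
  · exact Measure.measurePreserving_swap

variable [Countable X] [DiscreteMeasurableSpace X]

/-- The law of i.i.d. pairs is invariant under every coordinatewise swap, so the integral equals its
average over the `2 ^ m` swaps. -/
theorem lintegral_doubleSampleWeight_le {H : Set (X → Y)} {c : X → Y} {m N : ℕ}
    (D : Measure X) [IsProbabilityMeasure D]
    (hfin : ∀ z : Fin m → X × X, ((fun (h : X → Y) i => Prod.map h h (z i)) '' H).Finite)
    (hN : ∀ z : Fin m → X × X, ((fun (h : X → Y) i => Prod.map h h (z i)) '' H).ncard ≤ N) :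
    ∫⁻ z, doubleSampleWeight H c z ∂(Measure.pi fun _ : Fin m => D.prod D) ≤ N := by
  have hswap : ∀ σ : Fin m → Bool,
      ∫⁻ z, doubleSampleWeight H c (fun i => condSwap (σ i) (z i))
        ∂(Measure.pi fun _ : Fin m => D.prod D) =
      ∫⁻ z, doubleSampleWeight H c z ∂(Measure.pi fun _ : Fin m => D.prod D) := fun σ =>
    (measurePreserving_pi (fun _ : Fin m => D.prod D) (fun _ : Fin m => D.prod D)
      fun i => measurePreserving_condSwap D (σ i)).lintegral_comp (Measurable.of_discrete)
  have h2 : (2 : ℝ≥0∞) ^ m ≠ 0 := by positivity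
  have h2' : (2 : ℝ≥0∞) ^ m ≠ ∞ := ENNReal.pow_ne_top (by simp)
  refine (ENNReal.mul_le_mul_iff_left h2 h2').1 ?_
  calc (∫⁻ z, doubleSampleWeight H c z ∂(Measure.pi fun _ : Fin m => D.prod D)) * 2 ^ m
      = ∑ σ : Fin m → Bool, ∫⁻ z, doubleSampleWeight H c (fun i => condSwap (σ i) (z i))
        ∂(Measure.pi fun _ : Fin m => D.prod D) := by
        simp_rw [hswap]
        simp [mul_comm]
    _ = ∫⁻ z, ∑ σ : Fin m → Bool, doubleSampleWeight H c (fun i => condSwap (σ i) (z i))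
        ∂(Measure.pi fun _ : Fin m => D.prod D) :=
        (lintegral_finsetSum _ fun _ _ => Measurable.of_discrete).symm
    _ ≤ ∫⁻ _, (N : ℝ≥0∞) * 2 ^ m ∂(Measure.pi fun _ : Fin m => D.prod D) :=
        lintegral_mono fun z => sum_doubleSampleWeight_condSwap_le z (hfin z) (hN z)
    _ = N * 2 ^ m := by simp

/-- As `h` is correct on `x`, its weight is a product of independent factors `1 + 1[h errs at x'
i]`, each of mean at least `1 + ε`. -/
theorem one_add_pow_le_lintegral_doubleSampleWeight {H : Set (X → Y)} {c h : X → Y} {m : ℕ}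
    (D : Measure X) [IsProbabilityMeasure D] (hh : h ∈ H) {x : Fin m → X}
    (hx : ∀ i, h (x i) = c (x i)) {ε : ℝ≥0∞} (hε : ε ≤ D {x | h x ≠ c x}) :
    (1 + ε) ^ m ≤
      ∫⁻ x', doubleSampleWeight H c (fun i => (x i, x' i)) ∂(Measure.pi fun _ : Fin m => D) := by
  set g : X → ℝ≥0∞ := fun y => 1 + {x | h x ≠ c x}.indicator 1 y
  have hg : ∫⁻ y, g y ∂D = 1 + D {x | h x ≠ c x} := by
    rw [lintegral_add_left measurable_const, lintegral_indicator_one (.of_discrete)]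
    simp
  have hind := ProbabilityTheory.iIndepFun_pi (μ := fun _ : Fin m => D) (X := fun _ => g)
    fun _ => (Measurable.of_discrete).aemeasurable
  calc (1 + ε) ^ m ≤ (∫⁻ y, g y ∂D) ^ m := by rw [hg]; gcongr
    _ = ∏ i : Fin m, ∫⁻ x', g (x' i) ∂(Measure.pi fun _ : Fin m => D) := by
        have : ∀ i : Fin m, ∫⁻ x', g (x' i) ∂(Measure.pi fun _ : Fin m => D) = ∫⁻ y, g y ∂D :=
          fun i => (measurePreserving_eval (fun _ : Fin m => D) i).lintegral_comp
            (f := g) Measurable.of_discrete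
        simp [this]
    _ = ∫⁻ x', ∏ i : Fin m, g (x' i) ∂(Measure.pi fun _ : Fin m => D) :=
        (ProbabilityTheory.lintegral_prod_eq_prod_lintegral_of_indepFun Finset.univ _ hind
          fun _ => Measurable.of_discrete).symm
    _ ≤ _ := by
        refine lintegral_mono fun x' => ?_
        refine le_trans (le_of_eq ?_) (le_iSup₂ (f := fun (h : X → Y) (_ : h ∈ H) =>
          ∏ i, pairWeight (Prod.map h h (x i, x' i)) (Prod.map c c (x i, x' i))) h hh)
        refine Finset.prod_congr rfl fun i _ => ?_
        by_cases hi : h (x' i) = c (x' i) <;>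
          simp [g, pairWeight, hx i, hi, one_add_one_eq_two]

/-- The probability that some member of `H` fits an i.i.d. sample of size `m` and yet has
population error at least `ε`. -/
theorem measure_exists_consistent_mul_le {H : Set (X → Y)} {c : X → Y} {m N : ℕ}
    (D : Measure X) [IsProbabilityMeasure D]
    (hfin : ∀ z : Fin m → X × X, ((fun (h : X → Y) i => Prod.map h h (z i)) '' H).Finite)
    (hN : ∀ z : Fin m → X × X, ((fun (h : X → Y) i => Prod.map h h (z i)) '' H).ncard ≤ N)
    (ε : ℝ≥0∞) :
    (1 + ε) ^ m * (Measure.pi fun _ : Fin m => D)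
      {x | ∃ h ∈ H, (∀ i, h (x i) = c (x i)) ∧ ε ≤ D {x | h x ≠ c x}} ≤ N := by
  set μ := Measure.pi fun _ : Fin m => D
  set bad : Set (Fin m → X) := {x | ∃ h ∈ H, (∀ i, h (x i) = c (x i)) ∧ ε ≤ D {x | h x ≠ c x}}
  have hpres := measurePreserving_arrowProdEquivProdArrow X X (Fin m) (fun _ => D) fun _ => D
  calc (1 + ε) ^ m * μ bad = ∫⁻ _ in bad, (1 + ε) ^ m ∂μ := by rw [setLIntegral_const]
    _ ≤ ∫⁻ x in bad, ∫⁻ x', doubleSampleWeight H c (fun i => (x i, x' i)) ∂μ ∂μ := by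
        refine setLIntegral_mono' .of_discrete fun x hx => ?_
        obtain ⟨h, hh, hc, hε⟩ := hx
        exact one_add_pow_le_lintegral_doubleSampleWeight D hh hc hε
    _ ≤ ∫⁻ x, ∫⁻ x', doubleSampleWeight H c (fun i => (x i, x' i)) ∂μ ∂μ :=
        setLIntegral_le_lintegral _ _
    _ = ∫⁻ p, doubleSampleWeight H c (fun i => (p.1 i, p.2 i)) ∂(μ.prod μ) :=
        (lintegral_prod (fun p : (Fin m → X) × (Fin m → X) =>
          doubleSampleWeight H c (fun i => (p.1 i, p.2 i)))
          (Measurable.of_discrete).aemeasurable).symm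
    -- A pair of independent samples is regrouped as a sample of independent pairs, the form to
    -- which swaps apply.
    _ = ∫⁻ z, doubleSampleWeight H c z ∂(Measure.pi fun _ : Fin m => D.prod D) :=
        (hpres.lintegral_comp (f := fun p : (Fin m → X) × (Fin m → X) =>
          doubleSampleWeight H c (fun i => (p.1 i, p.2 i))) Measurable.of_discrete).symm
    _ ≤ N := lintegral_doubleSampleWeight_le D hfin hN

end Symmetrization

/-! ### Sample complexity of the consistency rule. -/

section SampleComplexity

/-- A sufficient sample size for end-to-end learning of a class of Littlestone dimension `d`. -/
noncomputable def e2eSampleSize (d T : ℕ) (ε δ : ℝ) : ℕ :=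
  if d = 0 then 0
  else ⌈4 / ε * (d * (Real.log 8 + Real.log T + Real.log ε⁻¹) + Real.log δ⁻¹)⌉₊

theorem sauerSum_le_mul_one_add_pow {d T m : ℕ} {ε δ : ℝ} (hd : 1 ≤ d) (hT : 1 ≤ T)
    (hε : 0 < ε) (hε1 : ε < 1) (hδ : 0 < δ) (hδ1 : δ < 1)
    (hm : 4 / ε * (d * (Real.log 8 + Real.log T + Real.log ε⁻¹) + Real.log δ⁻¹) ≤ m) :
    (sauerSum 1 (m * (T + T)) (d + 1) : ℝ) ≤ δ * (1 + ε) ^ m := by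
  have hd0 : (0 : ℝ) < d := by exact_mod_cast hd
  have hT1 : (1 : ℝ) ≤ T := by exact_mod_cast hT
  have hlT : 0 ≤ Real.log T := Real.log_nonneg hT1
  have hlε : 0 ≤ Real.log ε⁻¹ := Real.log_nonneg ((one_le_inv₀ hε).2 hε1.le)
  have hlδ : 0 ≤ Real.log δ⁻¹ := Real.log_nonneg ((one_le_inv₀ hδ).2 hδ1.le)
  have h8 : Real.log 8 = Real.log 2 + Real.log 4 := by
    rw [← Real.log_mul (by norm_num) (by norm_num)]; norm_num
  have h4 : Real.log 4 = 2 * Real.log 2 := by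
    rw [show (4 : ℝ) = 2 ^ 2 by norm_num, Real.log_pow]; norm_num
  have h2 := Real.log_two_gt_d9
  have hm' : 4 * (d * (Real.log 8 + Real.log T + Real.log ε⁻¹) + Real.log δ⁻¹) ≤ m * ε := by
    rw [div_mul_eq_mul_div, div_le_iff₀ hε] at hm
    exact hm
  have hdm : (d : ℝ) ≤ m := by
    have h1 : (m : ℝ) * ε ≤ m := mul_le_of_le_one_right (Nat.cast_nonneg m) hε1.le
    have h3 : (d : ℝ) * 2 ≤ d * (Real.log 8 + Real.log T + Real.log ε⁻¹) := by
      gcongr; linarith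
    linarith
  have hm0 : (0 : ℝ) < m := hd0.trans_le hdm
  have hr0 : (0 : ℝ) < m / d := by positivity
  have hcast : ((m * (T + T) : ℕ) : ℝ) * ((1 : ℕ) : ℝ) / d = 2 * T * (m / d) := by
    push_cast; ring
  refine (sauerSum_le hd ?_).trans ?_
  · push_cast
    nlinarith
  rw [hcast, ← Real.log_le_log_iff (by positivity) (by positivity), Real.log_pow,
    Real.log_mul (Real.exp_ne_zero _) (by positivity), Real.log_exp,
    Real.log_mul (by positivity) hr0.ne', Real.log_mul (by norm_num) (by positivity),
    Real.log_mul hδ.ne' (by positivity), Real.log_pow]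
  have h5 : ε / 2 ≤ Real.log (1 + ε) := by
    refine le_trans ?_ (Real.one_sub_inv_le_log_of_pos (by linarith))
    rw [show 1 - (1 + ε)⁻¹ = ε / (1 + ε) by field_simp; ring]
    gcongr
    linarith
  -- The tangent bound scaled by `ε / 4` spends half of the gain `m * ε / 2` from `h5`; the other
  -- half, `m * ε / 4`, pays for the terms in the sample size.
  have h6 : Real.log (m / d) ≤ m / d * (ε / 4) + Real.log 4 + Real.log ε⁻¹ - 1 := by
    have := Real.log_le_sub_one_of_pos (x := m / d * (ε / 4)) (by positivity)
    rw [Real.log_mul hr0.ne' (by positivity), Real.log_div hε.ne' (by norm_num)] at this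
    rw [Real.log_inv]
    linarith
  have h7 : (d : ℝ) * (1 + (Real.log 2 + Real.log T + Real.log (m / d))) ≤
      d * (1 + (Real.log 2 + Real.log T + (m / d * (ε / 4) + Real.log 4 + Real.log ε⁻¹ - 1))) := by
    gcongr
  have h9 : (d : ℝ) *
      (1 + (Real.log 2 + Real.log T + (m / d * (ε / 4) + Real.log 4 + Real.log ε⁻¹ - 1))) =
      d * (Real.log 8 + Real.log T + Real.log ε⁻¹) + m * ε / 4 := by
    rw [h8]; field_simp; ring
  have h10 : (m : ℝ) * (ε / 2) ≤ m * Real.log (1 + ε) := by gcongr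
  have h11 := Real.log_inv δ
  linarith

theorem e2eSampleSize_le {ε₀ : ℝ} (h₀ : 0 < ε₀) (h₁ : ε₀ < 1) {d T : ℕ} (hT : 2 ≤ T) {ε δ : ℝ}
    (hε : 0 < ε) (hε₀ : ε ≤ ε₀) (hδ : 0 < δ) (hδ1 : δ < 1) :
    (e2eSampleSize d T ε δ : ℝ) ≤ (8 + 18 / Real.log ε₀⁻¹) *
      (ε⁻¹ * ((d : ℝ) * Real.log T * Real.log ε⁻¹ + Real.log δ⁻¹)) := by
  have hlam : 0 < Real.log ε₀⁻¹ := Real.log_pos ((one_lt_inv₀ h₀).2 h₁)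
  have hlε : Real.log ε₀⁻¹ ≤ Real.log ε⁻¹ :=
    Real.log_le_log (by positivity) ((inv_le_inv₀ h₀ hε).2 hε₀)
  have hlδ : 0 ≤ Real.log δ⁻¹ := Real.log_nonneg ((one_le_inv₀ hδ).2 hδ1.le)
  have h2 := Real.log_two_gt_d9
  have hlT : Real.log 2 ≤ Real.log T := Real.log_le_log two_pos (by exact_mod_cast hT)
  have hlε0 := hlam.trans_le hlε
  have hlT0 : 0 < Real.log T := by linarith
  -- For `d = 0` the right side tends to 0 as `δ` tends to 1, so no positive sample size would do;
  -- hence the value 0 in `e2eSampleSize`.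
  rcases Nat.eq_zero_or_pos d with rfl | hd
  · simp only [e2eSampleSize, if_true, Nat.cast_zero]
    positivity
  have hd1 : (1 : ℝ) ≤ d := by exact_mod_cast hd
  have h8 : Real.log 8 = 3 * Real.log 2 := by
    rw [show (8 : ℝ) = 2 ^ 3 by norm_num, Real.log_pow]; norm_num
  have hε1 : 1 ≤ ε⁻¹ := (one_le_inv₀ hε).2 (hε₀.trans h₁.le)
  set A := Real.log T
  set B := Real.log ε⁻¹
  set l := Real.log ε₀⁻¹
  set E := Real.log δ⁻¹
  have hAB : A ≤ A * B / l := by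
    rw [le_div_iff₀ hlam]; gcongr
  have hB : B ≤ 2 * (A * B) := by nlinarith
  have hX : (d : ℝ) * (Real.log 8 + A + B) + E ≤ d * ((4 / l + 2) * (A * B)) + E := by
    have : (4 / l + 2) * (A * B) = 4 * (A * B / l) + 2 * (A * B) := by ring
    gcongr
    rw [this]
    linarith
  -- This absorbs the 1 lost to the ceiling and turns `16 / l` into `18 / l`.
  have hone : 1 ≤ ε⁻¹ * (2 / l * (d * (A * B))) := by
    have h1 : 1 ≤ 2 * (A * B / l) := by linarith
    have h3 : 2 / l * (d * (A * B)) = d * (2 * (A * B / l)) := by ring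
    rw [h3]
    exact one_le_mul_of_one_le_of_one_le hε1 (one_le_mul_of_one_le_of_one_le hd1 h1)
  have hpos : 0 ≤ 4 / ε * (d * (Real.log 8 + A + B) + E) := by
    have : 0 ≤ Real.log 8 := by rw [h8]; linarith
    positivity
  rw [e2eSampleSize, if_neg (by omega)]
  calc ((⌈4 / ε * (d * (Real.log 8 + A + B) + E)⌉₊ : ℕ) : ℝ)
      ≤ 4 / ε * (d * (Real.log 8 + A + B) + E) + 1 := (Nat.ceil_lt_add_one hpos).le
    _ ≤ 4 / ε * (d * ((4 / l + 2) * (A * B)) + E) + ε⁻¹ * (2 / l * (d * (A * B))) := by gcongr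
    _ = ε⁻¹ * ((8 + 18 / l) * (d * A * B) + 4 * E) := by ring
    _ ≤ ε⁻¹ * ((8 + 18 / l) * (d * A * B) + (8 + 18 / l) * E) := by
        have : 0 ≤ 18 / l := by positivity
        gcongr
        linarith
    _ = _ := by ring

theorem exists_isConsE2E (F : Set (List Bool → Bool)) (T : ℕ) :
    ∃ R : LearningRule, IsConsE2E F T R := by
  classical
  refine ⟨fun S => if h : ∃ f ∈ F, ∀ p ∈ S, e2e f T p.1 = p.2 then e2e h.choose T
    else fun _ => false, fun S h => ⟨h.choose, h.choose_spec.1, dif_pos h, h.choose_spec.2⟩⟩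

theorem IsConsE2E.exists_eq {F : Set (List Bool → Bool)} {T : ℕ} {R : LearningRule}
    (hR : IsConsE2E F T R) {f : List Bool → Bool} (hf : f ∈ F) {n : ℕ} (x : Fin n → List Bool) :
    ∃ g ∈ F, R (e2eSample f T x) = e2e g T ∧ ∀ i, e2e g T (x i) = e2e f T (x i) := by
  obtain ⟨g, hg, hRg, hcons⟩ := hR (e2eSample f T x) ⟨f, hf, fun p hp => by
    obtain ⟨i, rfl⟩ := (List.mem_ofFn' _ _).1 hp
    rfl⟩
  exact ⟨g, hg, hRg, fun i => hcons (x i, e2e f T (x i)) ((List.mem_ofFn' _ _).2 ⟨i, rfl⟩)⟩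

theorem subsingleton_of_not_littlestoneShatters_one {X Y : Type*} {F : Set (X → Y)}
    (hF : ¬ LittlestoneShatters 1 F) : F.Subsingleton := by
  intro f hf g hg
  by_contra hne
  obtain ⟨x, hx⟩ := Function.ne_iff.1 hne
  exact hF ⟨x, f x, g x, hx, ⟨f, hf, rfl⟩, ⟨g, hg, rfl⟩⟩

theorem one_sub_le_measure_popError {F : Set (List Bool → Bool)} {d : ℕ}
    (hF : ¬ LittlestoneShatters (d + 1) F) {T : ℕ} (hT : 1 ≤ T) {R : LearningRule}
    (hR : IsConsE2E F T R) (D : Measure (List Bool)) [IsProbabilityMeasure D]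
    {f : List Bool → Bool} (hf : f ∈ F) {ε δ : ℝ} (hε : 0 < ε) {m : ℕ}
    (hm : (sauerSum 1 (m * (T + T)) (d + 1) : ℝ) ≤ δ * (1 + ε) ^ m) :
    1 - δ ≤ (Measure.pi fun _ : Fin m => D).real
      {x | popError D f T (R (e2eSample f T x)) ≤ ε} := by
  set μ := Measure.pi fun _ : Fin m => D
  set good : Set (Fin m → List Bool) := {x | popError D f T (R (e2eSample f T x)) ≤ ε}
  set bad : Set (Fin m → List Bool) := {x | ∃ h ∈ e2eClass F T,
    (∀ i, h (x i) = e2e f T (x i)) ∧ ENNReal.ofReal ε ≤ D {x | h x ≠ e2e f T x}}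
  have hsub : goodᶜ ⊆ bad := by
    intro x hx
    obtain ⟨g, hg, hRg, hcons⟩ := hR.exists_eq hf x
    refine ⟨e2e g T, ⟨g, hg, rfl⟩, hcons, ?_⟩
    have hx' : ε < D.real {y | R (e2eSample f T x) y ≠ e2e f T y} := not_le.1 hx
    rw [hRg] at hx'
    rw [ENNReal.ofReal_le_iff_le_toReal (measure_ne_top _ _)]
    exact hx'.le
  -- Both points of a pair are evaluated, hence `T + T` queries per pair.
  have hQ : ∀ z : Fin m → List Bool × List Bool, QueryComputable (m * (T + T))
      fun (f : List Bool → Bool) i => Prod.map (e2e f T) (e2e f T) (z i) :=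
    QueryComputable.pi (ψ := fun (w : List Bool × List Bool) f => Prod.map (e2e f T) (e2e f T) w)
      fun w => (queryComputable_e2e hT w.1).bind (ψ := fun a f => (a, e2e f T w.2))
        fun a => (queryComputable_e2e hT w.2).map fun b => (a, b)
  have hbad : (1 + ENNReal.ofReal ε) ^ m * μ bad ≤ (sauerSum 1 (m * (T + T)) (d + 1) : ℕ) := by
    refine measure_exists_consistent_mul_le D (fun z => ?_) (fun z => ?_) (ENNReal.ofReal ε)
    · rw [e2eClass, Set.image_image]
      exact (hQ z).finite_range.subset (Set.image_subset_range _ _)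
    · rw [e2eClass, Set.image_image]
      exact (hQ z).ncard_image_le (by simp) hF
  have hreal : (1 + ε) ^ m * μ.real bad ≤ (sauerSum 1 (m * (T + T)) (d + 1) : ℝ) := by
    have := ENNReal.toReal_mono (ENNReal.natCast_ne_top _) hbad
    rwa [ENNReal.toReal_mul, ENNReal.toReal_pow, ENNReal.toReal_add (by simp) (by simp),
      ENNReal.toReal_ofReal hε.le, ENNReal.toReal_one, ENNReal.toReal_natCast] at this
  have hbad' : μ.real bad ≤ δ := by
    have hpos : (0 : ℝ) < (1 + ε) ^ m := by positivity
    refine le_of_mul_le_mul_left ?_ hpos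
    linarith
  have hcompl : μ.real goodᶜ = 1 - μ.real good := probReal_compl_eq_one_sub .of_discrete
  have := measureReal_mono (μ := μ) hsub
  linarith

theorem IsConsE2E.e2eLearns {F : Set (List Bool → Bool)} {d : ℕ}
    (hF : ¬ LittlestoneShatters (d + 1) F) {T : ℕ} (hT : 1 ≤ T) {R : LearningRule}
    (hR : IsConsE2E F T R) : E2ELearns F T R (e2eSampleSize d T) := by
  intro D _ f hf ε δ hε hε1 hδ hδ1
  rcases Nat.eq_zero_or_pos d with rfl | hd
  -- In dimension 0 the class has a single member, and the rule recovers it without data.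
  · have huniv : ∀ n, {x : Fin n → List Bool | popError D f T (R (e2eSample f T x)) ≤ ε} =
        Set.univ := by
      refine fun n => Set.eq_univ_of_forall fun x => ?_
      obtain ⟨g, hg, hRg, -⟩ := hR.exists_eq hf x
      obtain rfl := subsingleton_of_not_littlestoneShatters_one hF hf hg
      simp [popError, hRg, hε.le]
    rw [huniv]
    simp [hδ.le]
  · refine one_sub_le_measure_popError hF hT hR D hf hε
      (sauerSum_le_mul_one_add_pow hd hT hε hε1 hδ hδ1 ?_)
    rw [e2eSampleSize, if_neg (by omega)]
    exact Nat.le_ceil _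

end SampleComplexity

end AutoregressiveCoT

open AutoregressiveCoT
theorem mainTheorem5 :
    -- binary alphabet: VC dimension of the end-to-end class
    (∀ (F : Set (List Bool → Bool)) (T : ℕ), 2 ≤ T →
      (vcDim (e2eClass F T) : ℝ≥0∞) ≤ 10 * (ldim F : ℝ≥0∞) * ENNReal.ofReal (Real.log T)) ∧
    -- alphabet of any finite size `k`: Natarajan dimension of the end-to-end class
    (∀ (k : ℕ) (F : Set (List (Fin k) → Fin k)) (T : ℕ), 1 ≤ T →
      (natarajanDim (e2eClass F T) : ℝ≥0∞) ≤
        20 * (sfatDim 1 (realClass F) : ℝ≥0∞) * ENNReal.ofReal (Real.log ((T : ℝ) * k))) ∧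
    -- binary alphabet: sample complexity of the end-to-end consistency rule
    (∀ ε₀ : ℝ, 0 < ε₀ → ε₀ < 1 → ∃ C : ℝ, 0 < C ∧
      ∀ (F : Set (List Bool → Bool)) (d : ℕ), ldim F = (d : ℕ∞) → ∀ T : ℕ, 2 ≤ T →
        ∃ m : ℝ → ℝ → ℕ,
          (∃ R : LearningRule, IsConsE2E F T R) ∧
          (∀ R : LearningRule, IsConsE2E F T R → E2ELearns F T R m) ∧
          ∀ ε δ : ℝ, 0 < ε → ε ≤ ε₀ → 0 < δ → δ < 1 →
            (m ε δ : ℝ) ≤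
              C * (ε⁻¹ * ((d : ℝ) * Real.log T * Real.log ε⁻¹ + Real.log δ⁻¹))) := by
  refine ⟨fun F T hT => vcDim_e2eClass_le F hT, fun k F T hT => natarajanDim_e2eClass_le F hT,
    fun ε₀ h₀ h₁ => ?_⟩
  have hlam : 0 < Real.log ε₀⁻¹ := Real.log_pos ((one_lt_inv₀ h₀).2 h₁)
  refine ⟨8 + 18 / Real.log ε₀⁻¹, by positivity, fun F d hd T hT =>
    ⟨e2eSampleSize d T, exists_isConsE2E F T, fun R hR =>
      hR.e2eLearns (not_littlestoneShatters_of_ldim hd) (by omega), fun ε δ hε hε₀ hδ hδ1 =>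
      e2eSampleSize_le h₀ h₁ hT hε hε₀ hδ hδ1⟩⟩
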